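/- **Setting.** For $q\in\{1,2\}$ let $\Sigma_q:\ \dot x=A_qx+B_qu,\ y=Cx$ with real matrices $A_q\in\mathbb R^{n\times n}$, $B_q\in\mathbb R^{n\times m}$ of full column rank, and a common $C\in\mathbb R^{p\times n}$ of full row rank. A switching signal $\sigma:[0,\infty)\to\{1,2\}$ is admissible if it is piecewise constant with finitely many switches in every bounded interval. A switched affine system $\dot x=M_{\sigma}x+b_\sigma$ with equilibrium $x_e$ is GUAS if $x_e$ is stable and globally attractive, both uniformly over all admissible $\sigma$. Assume that $n+p<2m$, that each $\Sigma_q$ is right invertible (its transfer matrix $C(sI-A_q)^{-1}B_q$ has a rational right inverse), and that there are feedbacks $F_q$ for which $\dot x=(A_\sigma+B_\sigma F_\sigma)x$ is GUAS. Let $r\in\mathbb R^p$, and let $x_{\rm ss}\in\mathbb R^n$, $u_{1,\rm ss},u_{2,\rm ss}\in\mathbb R^m$ satisfy $A_qx_{\rm ss}+B_qu_{q,\rm ss}=0$ $(q=1,2)$ and $Cx_{\rm ss}=r$. **Intersections.** Let $C_{(0)}=C$, and for $1\le k\le p$ let $C_{(k)}$ be $C$ without its $k$-th row; let $p_{(k)}$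 be the number of rows of $C_{(k)}$, $m_{(k)}=m-p_{(k)}$, and $$R_{q,(k)}(\lambda)=\begin{bmatrix}\lambda I-A_q&B_q\\ C_{(k)}&0\end{bmatrix}.$$ Let $N_{q,(k)}(\lambda_q)$ and $M_{q,(k)}(\lambda_q)$ be rational matrices in $\lambda_q$, of sizes $n\times m_{(k)}$ and $m\times m_{(k)}$, such that the columns of $\begin{bmatrix}N_{q,(k)}\\M_{q,(k)}\end{bmatrix}$ form a basis of $\ker R_{q,(k)}(\lambda_q)$ over the field of rational functions. Let $T_{(k)}(\lambda_1,\lambda_2)$ be an invertible rational $n\times n$ matrix such that $T_{(k)}[N_{1,(k)}\ N_{2,(k)}]$ is in reduced row echelon form, let $E_{(k),12}$ be the block of its first $m_{(k)}$ rows and last $m_{(k)}$ columns, and let $$Q_{(k)}=T_{(k)}^{-1}\begin{bmatrix}E_{(k),12}\\0\end{bmatrix},\qquad P_{(k)}=Q_{(k)}\,{\rm diag}(q_1,\dots,q_{m_{(k)}}),$$ where $q_j\in\mathbb R[\lambda_1,\lambda_2]$ is the least common denominator of the $j$-th column of $Q_{(k)}$. Let $G_{(k)}\subset\mathbb R^2$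 be the set of points $(\lambda_1,\lambda_2)$ where $N_{1,(k)}$, $N_{2,(k)}$, $T_{(k)}$ are defined and $T_{(k)}(\lambda_1,\lambda_2)$ is invertible, and let $d_{(k)}=\dim\sum_{(\lambda_1,\lambda_2)\in G_{(k)}}{\rm im}\,Q_{(k)}(\lambda_1,\lambda_2)$. These choices are fixed throughout. **Partitioning, eigenvalues, eigenvectors.** Let $(d_0,\dots,d_p)$ be nonnegative integers with $d_k\le3$ for $k\ge1$ and $\sum_{k=0}^pd_k=n$ (a $(p,n)$-partitioning), feasible for the switched system, i.e. $d_k\le d_{(k)}$ for $k=0,\dots,p$. For $q\in\{1,2\}$ and $0\le k\le p$ let $\mathcal L_{q,k}=\{\lambda_{q,k,1},\dots,\lambda_{q,k,d_k}\}$ be sets of exactly $d_k$ negative real numbers, for each $q$ pairwise disjoint in $k$, indexed increasingly for $k\ge1$, with $\mathcal L_{1,k}\times\mathcal L_{2,k}\subset G_{(k)}$. With $\mathcal P_k=\sum_{(\lambda_1,\lambda_2)\in\mathcal L_{1,k}\times\mathcal L_{2,k}}{\rm im}\,P_{(k)}(\lambda_1,\lambda_2)$ suppose that $$\dim\Big(\mathcal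 P_0+\sum_{k\in S}\mathcal P_k\Big)\ \ge\ d_0+\sum_{k\in S}d_k\qquad\text{for every }S\subset\{1,\dots,p\}.$$ Let $v_{k,i}\in{\rm im}\,P_{(k)}(\lambda_{1,k,i},\lambda_{2,k,i})$, $0\le k\le p$, $1\le i\le d_k$, be linearly independent vectors, scaled so that for each $k\ge1$ the vector $Cv_{k,i}$ is the same multiple $s_k\mathbf e_k$ of the $k$-th canonical basis vector of $\mathbb R^p$ for all $i=1,\dots,d_k$. Put $V=[v_{0,1}\cdots v_{0,d_0}\ v_{1,1}\cdots v_{p,d_p}]$. **Initial states.** For $x_0\in\mathbb R^n$ let $[\alpha_{0,1},\dots,\alpha_{p,d_p}]^\top=V^{-1}(x_0-x_{\rm ss})$ be the modal coefficients. Let $\mathcal X_0$ be the set of all $x_0$ such that for each $k\in\{1,\dots,p\}$: * if $d_k=2$, then $(\alpha_{k,1}+\alpha_{k,2})\alpha_{k,2}>0$; * if $d_k=3$, then none of the following holds: I. $\alpha_{k,1}\alpha_{k,2}\ge0$, $\alpha_{k,1}\alpha_{k,3}<0$ and $|\alpha_{k,1}+\alpha_{k,2}|>|\alpha_{k,3}|$;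 II. $\alpha_{k,2}\alpha_{k,3}\ge0$, $\alpha_{k,1}\alpha_{k,2}<0$ and $|\alpha_{k,1}|>|\alpha_{k,2}+\alpha_{k,3}|$; III. $(\alpha_{k,2}+\alpha_{k,3})\alpha_{k,3}<0$. **Theorem (non-overshooting outputs).** There are vectors $w_{q,k,i}\in\mathbb R^m$ with $\begin{bmatrix}v_{k,i}\\w_{q,k,i}\end{bmatrix}\in\ker R_{q,(k)}(\lambda_{q,k,i})$ such that, with $W_q=[w_{q,0,1}\cdots w_{q,p,d_p}]$ (columns ordered as in $V$), $F_q=-W_qV^{-1}$ and $G_q=-F_qx_{\rm ss}+u_{q,\rm ss}$, the closed loop $$\dot x=(A_\sigma+B_\sigma F_\sigma)x+B_\sigma G_\sigma,\qquad y=Cx$$ is GUAS with equilibrium $x_{\rm ss}$, and for every $x_0\in\mathcal X_0$ and every admissible $\sigma$ the tracking of $r$ from $x(0)=x_0$ is non-overshooting: the error $e(t)=r-y(t)$ tends to $0$ as $t\to\infty$, and for each $k\in\{1,\dots,p\}$ the sign ${\rm sgn}(e_k(t))\in\{-1,0,1\}$ is constant for $t>0$. -/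

import Mathlib

open Matrix Filter Topology

noncomputable section

namespace SwitchedTracking

/-! ### Switched systems, trajectories, stability -/

/-- Two LTI subsystems `x' = A_q x + B_q u`, `y = C x` (indices `0, 1 : Fin 2`), with a common output
matrix of full row rank and input matrices of full column rank. -/
structure SwitchedSystem (n m p : ℕ) where
  A : Fin 2 → Matrix (Fin n) (Fin n) ℝ
  B : Fin 2 → Matrix (Fin n) (Fin m) ℝ
  C : Matrix (Fin p) (Fin n) ℝ
  rank_B : ∀ q, (B q).rank = m
  rank_C : C.rank = p

/-- Admissible switching signals on `[0, ∞)`: locally constant except for finitely many switching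
instants in every bounded interval (`Fin 2` is discrete). Only the values on `[0, ∞)` matter. -/
def IsAdmissible (σ : ℝ → Fin 2) : Prop :=
  ∀ T : ℝ, {t : ℝ | t ∈ Set.Icc 0 T ∧ ¬ ContinuousWithinAt σ (Set.Ici 0) t}.Finite

/-- `x` solves `x' = M_{σ(t)} x + b_{σ(t)}`, `x(0) = x₀` on `[0, ∞)`: it is continuous and satisfies
the differential equation away from the switching instants. -/
def IsTrajectory {n : ℕ} (M : Fin 2 → Matrix (Fin n) (Fin n) ℝ) (b : Fin 2 → Fin n → ℝ)
    (σ : ℝ → Fin 2) (x₀ : Fin n → ℝ) (x : ℝ → Fin n → ℝ) : Prop :=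
  ContinuousOn x (Set.Ici 0) ∧ x 0 = x₀ ∧
    ∀ t : ℝ, 0 < t → ContinuousAt σ t → HasDerivAt x (M (σ t) *ᵥ x t + b (σ t)) t

/-- Global uniform asymptotic stability under arbitrary switching of the equilibrium `xe` of
`x' = M_σ x + b_σ`: stability and global attractivity, both uniform over the admissible
switching signals. -/
def IsGUAS {n : ℕ} (M : Fin 2 → Matrix (Fin n) (Fin n) ℝ) (b : Fin 2 → Fin n → ℝ)
    (xe : Fin n → ℝ) : Prop :=
  (∀ q, M q *ᵥ xe + b q = 0) ∧
  (∀ ε : ℝ, 0 < ε → ∃ δ : ℝ, 0 < δ ∧ ∀ (σ : ℝ → Fin 2) (x₀ : Fin n → ℝ) (x : ℝ → Fin n → ℝ),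
    IsAdmissible σ → IsTrajectory M b σ x₀ x → ‖x₀ - xe‖ < δ → ∀ t : ℝ, 0 ≤ t → ‖x t - xe‖ < ε) ∧
  (∀ ρ ε : ℝ, 0 < ρ → 0 < ε → ∃ T : ℝ, 0 ≤ T ∧
    ∀ (σ : ℝ → Fin 2) (x₀ : Fin n → ℝ) (x : ℝ → Fin n → ℝ),
    IsAdmissible σ → IsTrajectory M b σ x₀ x → ‖x₀ - xe‖ < ρ → ∀ t : ℝ, T ≤ t → ‖x t - xe‖ < ε)

/-- The error converges to `0` and the sign of each of its components is constant on `(0, ∞)`. -/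
def IsNonOvershooting {p : ℕ} (e : ℝ → Fin p → ℝ) : Prop :=
  Tendsto e atTop (𝓝 0) ∧
    ∀ k : Fin p, ∀ s t : ℝ, 0 < s → 0 < t → SignType.sign (e s k) = SignType.sign (e t k)

/-- The transfer matrix `C (sI - A)⁻¹ B` over the field of rational functions. -/
def transferMatrix {n m p : ℕ} (A : Matrix (Fin n) (Fin n) ℝ) (B : Matrix (Fin n) (Fin m) ℝ)
    (C : Matrix (Fin p) (Fin n) ℝ) : Matrix (Fin p) (Fin m) (RatFunc ℝ) :=
  C.map RatFunc.C *
    ((RatFunc.X : RatFunc ℝ) • (1 : Matrix (Fin n) (Fin n) (RatFunc ℝ)) - A.map RatFunc.C)⁻¹ *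
    B.map RatFunc.C

/-- Right invertibility: the transfer matrix has a rational right inverse. -/
def IsRightInvertible {n m p : ℕ} (A : Matrix (Fin n) (Fin n) ℝ) (B : Matrix (Fin n) (Fin m) ℝ)
    (C : Matrix (Fin p) (Fin n) ℝ) : Prop :=
  ∃ X : Matrix (Fin m) (Fin p) (RatFunc ℝ), transferMatrix A B C * X = 1

namespace SwitchedSystem

variable {n m p : ℕ} (S : SwitchedSystem n m p)

/-- The closed-loop matrices `A_q + B_q F_q`. -/
def closedLoop (F : Fin 2 → Matrix (Fin m) (Fin n) ℝ) (q : Fin 2) : Matrix (Fin n) (Fin n) ℝ :=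
  S.A q + S.B q * F q

/-- Some state feedback `u = F_σ x` makes the closed loop GUAS. -/
def IsStabilisable : Prop :=
  ∃ F : Fin 2 → Matrix (Fin m) (Fin n) ℝ, IsGUAS (S.closedLoop F) 0 0

/-- The standing assumption: `n + p < 2m`, both subsystems are right invertible, and the
switched system is stabilisable. -/
def StandingAssumption : Prop :=
  n + p < 2 * m ∧ (∀ q, IsRightInvertible (S.A q) (S.B q) S.C) ∧ S.IsStabilisable

/-- `xss` is a common steady state with output `r` and constant inputs `u_q`. -/
def IsSteadyState (r : Fin p → ℝ) (xss : Fin n → ℝ) (u : Fin 2 → Fin m → ℝ) : Prop :=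
  (∀ q, S.A q *ᵥ xss + S.B q *ᵥ u q = 0) ∧ S.C *ᵥ xss = r

/-- The matrix `C_(k)`: `C_(0) = C`, and for `k = 1, …, p` the `k`-th row of `C` is removed.
(The 1-based row index `k` is `j : Fin p` with `j.succ = k`.) -/
def Ck (k : Fin (p + 1)) : Matrix {j : Fin p // j.succ ≠ k} (Fin n) ℝ :=
  S.C.submatrix Subtype.val id

/-- The Rosenbrock matrix `[[z I - A_q, B_q], [C_(k), 0]]` over a commutative `ℝ`-algebra. -/
def rosenbrock {R : Type} [CommRing R] [Algebra ℝ R] (q : Fin 2) (k : Fin (p + 1)) (z : R) :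
    Matrix (Fin n ⊕ {j : Fin p // j.succ ≠ k}) (Fin n ⊕ Fin m) R :=
  Matrix.fromBlocks (z • (1 : Matrix (Fin n) (Fin n) R) - (S.A q).map (algebraMap ℝ R))
    ((S.B q).map (algebraMap ℝ R)) ((S.Ck k).map (algebraMap ℝ R)) 0

end SwitchedSystem

/-! ### Rational functions of `(λ₁, λ₂)` -/

/-- Real polynomials in `(λ₁, λ₂)`. -/
abbrev Poly2 : Type := MvPolynomial (Fin 2) ℝ

/-- Real rational functions in `(λ₁, λ₂)`. -/
abbrev Rat2 : Type := FractionRing Poly2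

/-- The indeterminate `λ_q` as a rational function. -/
def ratVar (q : Fin 2) : Rat2 := algebraMap Poly2 Rat2 (MvPolynomial.X q)

/-- The reduced denominator of `f` does not vanish at the point `z`. -/
def RegularAt (z : Fin 2 → ℝ) (f : Rat2) : Prop :=
  MvPolynomial.eval z (IsFractionRing.den Poly2 f : Poly2) ≠ 0

/-- The value of a rational function at `z` (meaningful where it is regular). -/
def evalRat (z : Fin 2 → ℝ) (f : Rat2) : ℝ :=
  MvPolynomial.eval z (IsFractionRing.num Poly2 f) /
    MvPolynomial.eval z (IsFractionRing.den Poly2 f : Poly2)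

/-- Reduced row echelon form, with `r` pivots in the columns `piv 0 < piv 1 < …`. -/
def IsRREF {a b : ℕ} {K : Type} [Field K] (E : Matrix (Fin a) (Fin b) K) : Prop :=
  ∃ (r : ℕ) (hr : r ≤ a) (piv : Fin r → Fin b), StrictMono piv ∧
    (∀ (i : Fin a) (l : Fin r), E i (piv l) = if (i : ℕ) = (l : ℕ) then 1 else 0) ∧
    (∀ (l : Fin r) (j : Fin b), j < piv l → E (Fin.castLE hr l) j = 0) ∧
    (∀ i : Fin a, r ≤ (i : ℕ) → ∀ j, E i j = 0)

/-! ### The intersections of the assignable eigenvector spaces -/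

/-- `m_(k) = m - p_(k)`, where `p_(k)` is the number of rows of `C_(k)`. -/
def kerDim (m : ℕ) {p : ℕ} (k : Fin (p + 1)) : ℕ := m - Fintype.card {j : Fin p // j.succ ≠ k}

/-- The matrix `[N₁ N₂]`. -/
def hcat {n c : ℕ} {K : Type} (N : Fin 2 → Matrix (Fin n) (Fin c) K) :
    Matrix (Fin n) (Fin (c + c)) K :=
  Matrix.of fun i => Fin.append (N 0 i) (N 1 i)

/-- The matrix `[E₁₂; 0; 0]`: the last `c` columns of `E`, with all rows below the `c`-th one
replaced by zero. -/
def upperRight {n c : ℕ} {K : Type} [Zero K] (E : Matrix (Fin n) (Fin (c + c)) K) :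
    Matrix (Fin n) (Fin c) K :=
  Matrix.of fun i j => if (i : ℕ) < c then E i (Fin.natAdd c j) else 0

/-- The (non-unique) choices behind the matrix functions for the index `k`. -/
structure RowReduction {n m p : ℕ} (S : SwitchedSystem n m p) (k : Fin (p + 1)) where
  /-- `N_{q,(k)}(λ_q)` -/
  N : Fin 2 → Matrix (Fin n) (Fin (kerDim m k)) Rat2
  /-- `M_{q,(k)}(λ_q)` -/
  M : Fin 2 → Matrix (Fin m) (Fin (kerDim m k)) Rat2
  /-- `N_{q,(k)}` is a function of `λ_q` only. -/
  N_mem : ∀ q i j, N q i j ∈ IntermediateField.adjoin ℝ {ratVar q}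
  /-- `M_{q,(k)}` is a function of `λ_q` only. -/
  M_mem : ∀ q i j, M q i j ∈ IntermediateField.adjoin ℝ {ratVar q}
  /-- The columns of `[N; M]` are linearly independent. -/
  linInd : ∀ q, LinearIndependent Rat2 (Matrix.fromRows (N q) (M q)).col
  /-- `im [N; M] = ker R_{q,(k)}(λ_q)` -/
  range_eq_ker : ∀ q, LinearMap.range (Matrix.fromRows (N q) (M q)).mulVecLin =
    LinearMap.ker (S.rosenbrock q k (ratVar q)).mulVecLin
  /-- The transformation `T_(k)(λ₁, λ₂)`. -/
  T : Matrix (Fin n) (Fin n) Rat2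
  /-- `T_(k)` is invertible over the field of rational functions. -/
  T_unit : IsUnit T.det
  /-- `T_(k)` takes `[N₁ N₂]` to its reduced row echelon form. -/
  rref : IsRREF (T * hcat N)

namespace RowReduction

variable {n m p : ℕ} {S : SwitchedSystem n m p} {k : Fin (p + 1)} (D : RowReduction S k)

/-- `Q_(k) = T_(k)⁻¹ [E₁₂; 0; 0]` -/
def Q : Matrix (Fin n) (Fin (kerDim m k)) Rat2 := D.T⁻¹ * upperRight (D.T * hcat D.N)

/-- `G_(k)`: the points `(λ₁, λ₂)` at which `[N₁ N₂]` and `T_(k)` are defined and `T_(k)(λ₁, λ₂)`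
is invertible. -/
def G : Set (Fin 2 → ℝ) :=
  {z | (∀ q i j, RegularAt z (D.N q i j)) ∧ (∀ i j, RegularAt z (D.T i j)) ∧
    IsUnit (D.T.map (evalRat z)).det}

/-- `d_(k)`, the dimension of the sum of `im Q_(k)(λ₁, λ₂)` over `G_(k)`. -/
def dim : ℕ :=
  Module.finrank ℝ ↥(⨆ z ∈ D.G, LinearMap.range (D.Q.map (evalRat z)).mulVecLin)

end RowReduction

/-- The polynomial matrix `P_(k)`, obtained by multiplying each column of `Q_(k)` by its least
common denominator `q_j` (unique up to a nonzero constant factor). -/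
structure IntersectionRep {n m p : ℕ} (S : SwitchedSystem n m p) (k : Fin (p + 1)) extends
    RowReduction S k where
  q : Fin (kerDim m k) → Poly2
  q_lcd : ∀ j (f : Poly2),
    q j ∣ f ↔ ∀ i, (IsFractionRing.den Poly2 (toRowReduction.Q i j) : Poly2) ∣ f
  P : Matrix (Fin n) (Fin (kerDim m k)) Poly2
  P_eq : P.map (algebraMap Poly2 Rat2) =
    toRowReduction.Q * Matrix.diagonal (fun j => algebraMap Poly2 Rat2 (q j))

/-- `im P_(k)(λ₁, λ₂)` -/
def IntersectionRep.imP {n m p : ℕ} {S : SwitchedSystem n m p} {k : Fin (p + 1)}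
    (D : IntersectionRep S k) (l₁ l₂ : ℝ) : Submodule ℝ (Fin n → ℝ) :=
  LinearMap.range (D.P.map (MvPolynomial.eval ![l₁, l₂])).mulVecLin

/-! ### Partitionings, eigenvalues, eigenvectors -/

/-- `(d_0, …, d_p)` is a `(p, n)`-partitioning. -/
structure IsPartitioning (n : ℕ) {p : ℕ} (d : Fin (p + 1) → ℕ) : Prop where
  le_three : ∀ k : Fin p, d k.succ ≤ 3
  sum_eq : ∑ k, d k = n

/-- The partitioning is feasible for the switched system: `d_k ≤ d_(k)` for all `k`. -/
def IsFeasible {n m p : ℕ} {S : SwitchedSystem n m p} (D : ∀ k, IntersectionRep S k)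
    (d : Fin (p + 1) → ℕ) : Prop :=
  ∀ k, d k ≤ (D k).toRowReduction.dim

/-- The sets `L_k = {L k 0, …, L k (d_k - 1)}` are compatible with `(d_0, …, d_p)`: they have `d_k`
elements, are pairwise disjoint, and are indexed increasingly for `k = 1, …, p`. -/
structure IsCompatible {p : ℕ} {d : Fin (p + 1) → ℕ} (L : ∀ k, Fin (d k) → ℝ) : Prop where
  inj : ∀ k, Function.Injective (L k)
  strictMono : ∀ k : Fin p, StrictMono (L k.succ)
  disjoint : ∀ k k', k ≠ k' → Disjoint (Set.range (L k)) (Set.range (L k'))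

/-- The sum of `im P_(k)(λ₁, λ₂)` over `L_{1,k} × L_{2,k}`. -/
def sumP {n m p : ℕ} {S : SwitchedSystem n m p} (D : ∀ k, IntersectionRep S k)
    {d : Fin (p + 1) → ℕ} (L : Fin 2 → ∀ k, Fin (d k) → ℝ) (k : Fin (p + 1)) :
    Submodule ℝ (Fin n → ℝ) :=
  ⨆ (i : Fin (d k)) (j : Fin (d k)), (D k).imP (L 0 k i) (L 1 k j)

/-- The position of the double index `(k, i)` in `(0,1), …, (0,d_0), (1,1), …, (p,d_p)`. -/
def colIndex {n p : ℕ} {d : Fin (p + 1) → ℕ} (hd : IsPartitioning n d) :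
    (Σ k, Fin (d k)) ≃ Fin n :=
  finSigmaFinEquiv.trans (finCongr hd.sum_eq)

/-- The matrix `[v_{0,1} … v_{0,d_0} v_{1,1} … v_{p,d_p}]`. -/
def colMatrix {n p a : ℕ} {d : Fin (p + 1) → ℕ} (hd : IsPartitioning n d)
    (v : ∀ k, Fin (d k) → Fin a → ℝ) : Matrix (Fin a) (Fin n) ℝ :=
  Matrix.of fun i j => v ((colIndex hd).symm j).1 ((colIndex hd).symm j).2 i

/-! ### The set of initial states -/

/-- The condition on the coefficients of a component to which `c` modes are assigned. -/
def CoeffCondition : (c : ℕ) → (Fin c → ℝ) → Prop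
  | 2, a => 0 < (a 0 + a 1) * a 1
  | 3, a =>
      ¬ (0 ≤ a 0 * a 1 ∧ a 0 * a 2 < 0 ∧ |a 2| < |a 0 + a 1|) ∧
      ¬ (0 ≤ a 1 * a 2 ∧ a 0 * a 1 < 0 ∧ |a 1 + a 2| < |a 0|) ∧
      ¬ ((a 1 + a 2) * a 2 < 0)
  | _, _ => True

/-- `H_k`: linear combinations of `v_{k,1}, …, v_{k,d_k}`, whose coefficients satisfy the sign
conditions if `k ≠ 0`. -/
def setH {n p : ℕ} {d : Fin (p + 1) → ℕ} (v : ∀ k, Fin (d k) → Fin n → ℝ) (k : Fin (p + 1)) :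
    Set (Fin n → ℝ) :=
  {ξ | ∃ a : Fin (d k) → ℝ, ξ = ∑ i, a i • v k i ∧ (k ≠ 0 → CoeffCondition (d k) a)}

/-- The modal coefficients `V⁻¹ ξ`, indexed by `(k, i)`. -/
def modalCoeff {n p : ℕ} {d : Fin (p + 1) → ℕ} (hd : IsPartitioning n d)
    (v : ∀ k, Fin (d k) → Fin n → ℝ) (ξ : Fin n → ℝ) (k : Fin (p + 1)) (i : Fin (d k)) : ℝ :=
  ((colMatrix hd v)⁻¹ *ᵥ ξ) (colIndex hd ⟨k, i⟩)

/-- The component of `ξ` in the span of `v_{k,1}, …, v_{k,d_k}` in the modal decomposition. -/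
def modalProj {n p : ℕ} {d : Fin (p + 1) → ℕ} (hd : IsPartitioning n d)
    (v : ∀ k, Fin (d k) → Fin n → ℝ) (k : Fin (p + 1)) (ξ : Fin n → ℝ) : Fin n → ℝ :=
  ∑ i, modalCoeff hd v ξ k i • v k i

/-- The set of initial states. -/
def setX {n p : ℕ} {d : Fin (p + 1) → ℕ} (hd : IsPartitioning n d)
    (v : ∀ k, Fin (d k) → Fin n → ℝ) (xss : Fin n → ℝ) : Set (Fin n → ℝ) :=
  {x₀ | ∀ k, modalProj hd v k (x₀ - xss) ∈ setH v k}

end SwitchedTracking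

end

/-!
The vectors `v_{k,i}` turn out to be common eigenvectors of both closed loops, so that the switched
system decouples into scalar equations in the basis which they form.

*Assignability.* Over the field of rational functions, the columns of `Q_(k)` lie in the column
spaces of both `N_{1,(k)}` and `N_{2,(k)}` (`rref_intersection`): since `N_{1,(k)}` has full column
rank, the reduced row echelon form of `[N₁ N₂]` is `[1 E₁₂; 0 E₂₂]`, whence `Q_(k) = N₁ E₁₂`, which
differs from `N₂` by combinations of those columns of `N₂` that carry the pivots of `E₂₂`. So the
columns of the polynomial matrix `P_(k)` extend to kernel vectors of both Rosenbrock matrices. As `B_q` has a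
left inverse, the input part of the kernel vector can be chosen polynomial too, and the kernel
equation becomes a polynomial identity, which may be evaluated at every point
(`IntersectionRep.exists_input`). This provides the `w_{q,k,i}`, and `F_q = -W_q V⁻¹` gives
`(A_q + B_q F_q) V = V diag(λ_{q,k,i})` for both `q` (`SwitchedSystem.closedLoop_mul_colMatrix`).

*Stability.* Each modal coordinate of `x - x_ss` satisfies `y' = λ_{σ,k,i} y`, so that
`y(t) = exp (∑_q λ_{q,k,i} τ_q(t)) y(0)`, where `τ_q(t)` is the time spent in mode `q` up to time `t`
(`IsTrajectory.modes_eq`). All eigenvalues are negative and `τ_1(t) + τ_2(t) = t`, which yields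
an exponential bound uniform in `σ`.

*Signs.* By the choice of the `v_{k,i}`, the component `e_k` of the error is `-s_k` times the sum of
the at most three modes `(k, i)`. At every `t > 0` the exponentials of these modes are strictly
ordered in the same way, because the eigenvalues are, for both subsystems. For coefficients
satisfying the sign conditions, this ordering alone determines the sign of the sum
(`sign_sum_modes`).
-/

namespace SwitchedTracking

/-! ### Reduced row echelon forms and intersections of column spaces -/

lemma hcat_castAdd {n c : ℕ} {K : Type} (N : Fin 2 → Matrix (Fin n) (Fin c) K) (i : Fin n)
    (j : Fin c) : hcat N i (Fin.castAdd c j) = N 0 i j := by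
  simp [hcat]

lemma hcat_natAdd {n c : ℕ} {K : Type} (N : Fin 2 → Matrix (Fin n) (Fin c) K) (i : Fin n)
    (j : Fin c) : hcat N i (Fin.natAdd c j) = N 1 i j := by
  rw [hcat, Matrix.of_apply, Fin.append_right]

/-- If the first `c` columns of a reduced row echelon form are linearly independent, they are the
first `c` standard basis vectors, and the first `c` pivots are in these columns. -/
lemma pivot_eq_castAdd {n c r : ℕ} {K : Type} [Field K] {E : Matrix (Fin n) (Fin (c + c)) K}
    (hr : r ≤ n) {piv : Fin r → Fin (c + c)} (hmono : StrictMono piv)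
    (hpiv : ∀ (i : Fin n) (l : Fin r), E i (piv l) = if (i : ℕ) = (l : ℕ) then 1 else 0)
    (hleft : ∀ (l : Fin r) (j : Fin (c + c)), j < piv l → E (Fin.castLE hr l) j = 0)
    (hzero : ∀ i : Fin n, r ≤ (i : ℕ) → ∀ j, E i j = 0)
    (hinj : ∀ x : Fin c → K, (∀ i, ∑ j, E i (Fin.castAdd c j) * x j = 0) → x = 0) :
    ∀ (j : ℕ) (hj : j < c), ∃ h : j < r, piv ⟨j, h⟩ = Fin.castAdd c ⟨j, hj⟩ := by
  intro j
  induction j using Nat.strong_induction_on with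
  | _ j ih =>
  intro hj
  by_contra hcon
  -- Column `j` is not a pivot column, so it vanishes from row `j` on and is a combination of the
  -- preceding columns, which are standard basis vectors.
  have hcol : ∀ i : Fin n, j ≤ (i : ℕ) → E i (Fin.castAdd c ⟨j, hj⟩) = 0 := by
    intro i hi
    by_cases hir : r ≤ (i : ℕ)
    · exact hzero i hir _
    push Not at hir
    have hjr : j < r := lt_of_le_of_lt hi hir
    have hne : piv ⟨j, hjr⟩ ≠ Fin.castAdd c ⟨j, hj⟩ := fun h => hcon ⟨hjr, h⟩
    have hge : j ≤ (piv ⟨j, hjr⟩ : ℕ) := by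
      by_contra hlt
      push Not at hlt
      obtain ⟨h', hp⟩ := ih _ hlt (hlt.trans hj)
      have : piv ⟨(piv ⟨j, hjr⟩ : ℕ), h'⟩ = piv ⟨j, hjr⟩ := by
        rw [hp]; ext; simp
      have := congrArg Fin.val (hmono.injective this)
      simp at this
      omega
    have hgt : Fin.castAdd c ⟨j, hj⟩ < piv ⟨j, hjr⟩ := by
      refine lt_of_le_of_ne ?_ hne.symm
      simpa [Fin.le_def] using hge
    have hle : piv ⟨j, hjr⟩ ≤ piv ⟨i, hir⟩ := hmono.monotone (by simpa [Fin.le_def] using hi)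
    exact hleft ⟨i, hir⟩ _ (lt_of_lt_of_le hgt hle)
  have hn : ∀ l : Fin c, (l : ℕ) < j → (l : ℕ) < n := fun l hl =>
    lt_of_lt_of_le (ih l hl l.2).1 hr
  have h0 := hinj (fun l => if h : (l : ℕ) < j then
      - E ⟨l, hn l h⟩ (Fin.castAdd c ⟨j, hj⟩) else if (l : ℕ) = j then 1 else 0) ?_
  · have := congrFun h0 ⟨j, hj⟩
    simp at this
  intro i
  have hE : ∀ l : Fin c, (l : ℕ) < j →
      E i (Fin.castAdd c l) = if (i : ℕ) = (l : ℕ) then 1 else 0 := by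
    intro l hl
    obtain ⟨h, hp⟩ := ih l hl l.2
    rw [← hp, hpiv]
  by_cases hij : (i : ℕ) < j
  · rw [Finset.sum_eq_add (⟨i, hij.trans hj⟩ : Fin c) ⟨j, hj⟩]
    · rw [hE ⟨i, hij.trans hj⟩ hij]
      simp only [hij, dite_true, if_true, one_mul, lt_irrefl, dite_false, mul_one]
      exact neg_add_cancel _
    · simp [Fin.ext_iff]; omega
    · intro l _ hl
      by_cases hlj : (l : ℕ) < j
      · have : (i : ℕ) ≠ l := fun h => hl.1 (Fin.ext h.symm)
        simp [hE l hlj, this]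
      · have : (l : ℕ) ≠ j := fun h => hl.2 (Fin.ext h)
        simp [hlj, this]
    · simp
    · simp
  · apply Finset.sum_eq_zero
    intro l _
    by_cases hlj : (l : ℕ) < j
    · have : (i : ℕ) ≠ l := by omega
      simp [hE l hlj, this]
    · by_cases hl : (l : ℕ) = j
      · have : l = ⟨j, hj⟩ := Fin.ext hl
        subst this
        rw [hcol i (by omega), zero_mul]
      · simp [hlj, hl]

/-- If `N 0` is injective, the columns of `T⁻¹ [E₁₂; 0]`, where `E = T [N₁ N₂]` is in reduced row
echelon form, lie in both column spaces. With `E = [1 E₁₂; 0 E₂₂]`, they are the columns of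
`N₁ E₁₂`, and they differ from the columns of `N₂` by combinations of those columns of `N₂` which
carry the pivots of `E₂₂`. -/
lemma rref_intersection {n c : ℕ} {K : Type} [Field K] (N : Fin 2 → Matrix (Fin n) (Fin c) K)
    (T : Matrix (Fin n) (Fin n) K) (hT : IsUnit T.det) (hE : IsRREF (T * hcat N))
    (hN : Function.Injective (N 0).mulVec) (j : Fin c) (q : Fin 2) :
    ∃ x, N q *ᵥ x = (T⁻¹ * upperRight (T * hcat N)).col j := by
  obtain ⟨r, hr, piv, hmono, hpiv, hleft, hzero⟩ := hE
  have hTinj : Function.Injective T.mulVec :=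
    Matrix.mulVec_injective_of_isUnit ((Matrix.isUnit_iff_isUnit_det T).2 hT)
  have hL : ∀ i l, (T * hcat N) i (Fin.castAdd c l) = (T * N 0) i l := by
    intro i l; simp only [Matrix.mul_apply, hcat_castAdd]
  have hR : ∀ i l, (T * hcat N) i (Fin.natAdd c l) = (T * N 1) i l := by
    intro i l; simp only [Matrix.mul_apply, hcat_natAdd]
  generalize T * hcat N = E at *
  have hP := pivot_eq_castAdd hr hmono hpiv hleft hzero (by
    intro x hx
    apply hN
    apply hTinj
    rw [Matrix.mulVec_mulVec]
    ext i
    simpa [hL, Matrix.mulVec, dotProduct] using hx i)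
  suffices h : ∃ x, (T * N q) *ᵥ x = (upperRight E).col j by
    obtain ⟨x, hx⟩ := h
    refine ⟨x, hTinj ?_⟩
    rw [Matrix.mulVec_mulVec, hx]
    have : T * (T⁻¹ * upperRight E) = upperRight E := by
      rw [← Matrix.mul_assoc, Matrix.mul_nonsing_inv _ hT, Matrix.one_mul]
    conv_lhs => rw [← this]
    rfl
  have hcr : ∀ l : ℕ, l < c → l < r := fun l hl => (hP l hl).1
  have hI : ∀ (i : Fin n) (l : Fin c),
      E i (Fin.castAdd c l) = if (i : ℕ) = (l : ℕ) then 1 else 0 := by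
    intro i l
    obtain ⟨h, hp⟩ := hP l l.2
    rw [← hp, hpiv]
  fin_cases q
  · refine ⟨fun l => E ⟨l, (hcr l l.2).trans_le hr⟩ (Fin.natAdd c j), ?_⟩
    ext i
    simp only [Fin.zero_eta, Matrix.mulVec, dotProduct, ← hL, hI, upperRight, Matrix.col_apply,
      Matrix.of_apply, ite_mul, one_mul, zero_mul]
    by_cases hic : (i : ℕ) < c
    · rw [Finset.sum_eq_single ⟨i, hic⟩]
      · simp [hic]
      · intro l _ hl
        rw [if_neg fun h => hl (Fin.ext h.symm)]
      · simp
    · rw [if_neg hic]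
      apply Finset.sum_eq_zero
      intro l _
      rw [if_neg (by omega)]
  · -- The column is `E_j` minus the pivot columns in the second block.
    have hmem : ∀ l : Fin r, c ≤ (l : ℕ) →
        (fun i => E i (piv l)) ∈ LinearMap.range (T * N 1).mulVecLin := by
      intro l hl
      have hge : c ≤ (piv l : ℕ) := by
        by_contra hlt
        push Not at hlt
        obtain ⟨h', hp⟩ := hP _ hlt
        have : piv ⟨(piv l : ℕ), h'⟩ = piv l := by
          rw [hp]; ext; simp
        have := congrArg Fin.val (hmono.injective this)
        simp at this
        omega
      have hlt := (piv l).2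
      have : piv l = Fin.natAdd c ⟨(piv l : ℕ) - c, by omega⟩ := by
        ext; simp; omega
      rw [this]
      refine ⟨Pi.single ⟨(piv l : ℕ) - c, by omega⟩ 1, ?_⟩
      ext i
      rw [hR, Matrix.mulVecLin_apply, Matrix.mulVec_single_one, Matrix.col_apply]
    have hj : (fun i => E i (Fin.natAdd c j)) ∈ LinearMap.range (T * N 1).mulVecLin := by
      refine ⟨Pi.single j 1, ?_⟩
      ext i
      rw [hR, Matrix.mulVecLin_apply, Matrix.mulVec_single_one, Matrix.col_apply]
    have hsum := Submodule.sub_mem _ hj (Submodule.sum_mem _ (t := Finset.univ.filter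
      fun l : Fin r => c ≤ (l : ℕ)) fun l hl => Submodule.smul_mem _
        (E (Fin.castLE hr l) (Fin.natAdd c j)) (hmem l (by simpa using hl)))
    obtain ⟨x, hx⟩ := hsum
    refine ⟨x, ?_⟩
    rw [Matrix.mulVecLin_apply] at hx
    refine Eq.trans hx ?_
    ext i
    simp only [Pi.sub_apply, Finset.sum_apply, Pi.smul_apply, smul_eq_mul, hpiv, mul_ite, mul_one,
      mul_zero, Matrix.col_apply, upperRight, Matrix.of_apply]
    by_cases hic : (i : ℕ) < c
    · rw [if_pos hic, Finset.sum_eq_zero, sub_zero]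
      intro l hl
      rw [if_neg]
      have : c ≤ (l : ℕ) := by simpa using hl
      omega
    · rw [if_neg hic]
      by_cases hir : (i : ℕ) < r
      · rw [Finset.sum_eq_single (⟨i, hir⟩ : Fin r)]
        · simp
        · intro l _ hl
          rw [if_neg fun h => hl (Fin.ext h.symm)]
        · intro h
          exact absurd (by simpa using hic) h
      · rw [hzero i (by omega), Finset.sum_eq_zero, sub_zero]
        intro l _
        rw [if_neg (by omega)]

/-! ### Kernels of the Rosenbrock matrices -/

lemma exists_left_inverse_of_rank_eq {n m : ℕ} (B : Matrix (Fin n) (Fin m) ℝ) (hB : B.rank = m) :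
    ∃ Y : Matrix (Fin m) (Fin n) ℝ, Y * B = 1 := by
  have hli : LinearIndependent ℝ B.col := by
    rw [linearIndependent_iff_card_eq_finrank_span, Set.finrank,
      ← Matrix.rank_eq_finrank_span_cols, hB, Fintype.card_fin]
  have hinj : LinearMap.ker B.mulVecLin = ⊥ :=
    LinearMap.ker_eq_bot.2 (Matrix.mulVec_injective_iff.2 hli)
  obtain ⟨g, hg⟩ := B.mulVecLin.exists_leftInverse_of_injective hinj
  refine ⟨LinearMap.toMatrix' g, ?_⟩
  have h := congrArg LinearMap.toMatrix' hg
  rw [LinearMap.toMatrix'_comp, LinearMap.toMatrix'_id] at h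
  simpa [← Matrix.toLin'_apply'] using h

namespace SwitchedSystem

variable {n m p : ℕ} (S : SwitchedSystem n m p)

lemma rosenbrock_mulVec_eq_zero_iff {R : Type} [CommRing R] [Algebra ℝ R] (q : Fin 2)
    (k : Fin (p + 1)) (z : R) (v : Fin n → R) (w : Fin m → R) :
    S.rosenbrock q k z *ᵥ Sum.elim v w = 0 ↔
      (z • v - (S.A q).map (algebraMap ℝ R) *ᵥ v + (S.B q).map (algebraMap ℝ R) *ᵥ w = 0 ∧
        (S.Ck k).map (algebraMap ℝ R) *ᵥ v = 0) := by
  rw [rosenbrock, Matrix.fromBlocks_mulVec]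
  simp only [Sum.elim_comp_inl, Sum.elim_comp_inr, Matrix.sub_mulVec, Matrix.smul_mulVec,
    Matrix.one_mulVec, Matrix.zero_mulVec, add_zero]
  constructor
  · intro h
    exact ⟨funext fun i => congrFun h (Sum.inl i), funext fun i => congrFun h (Sum.inr i)⟩
  · rintro ⟨h1, h2⟩
    rw [h1, h2]
    ext (i | i) <;> rfl

/-- Homomorphisms of `ℝ`-algebras take products with Rosenbrock matrices to such
products. -/
lemma rosenbrock_map {R R' : Type} [CommRing R] [Algebra ℝ R] [CommRing R'] [Algebra ℝ R']
    (f : R →ₐ[ℝ] R') (q : Fin 2) (k : Fin (p + 1)) (z : R) (v : Fin n → R) (w : Fin m → R) :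
    S.rosenbrock q k (f z) *ᵥ Sum.elim (f ∘ v) (f ∘ w) =
      f ∘ (S.rosenbrock q k z *ᵥ Sum.elim v w) := by
  have h1 : S.rosenbrock q k (f z) = (S.rosenbrock q k z).map f := by
    have hA : ∀ {a b : Type} (X : Matrix a b ℝ), X.map (algebraMap ℝ R') =
        (X.map (algebraMap ℝ R)).map f := by
      intro a b X; ext; simp
    rw [rosenbrock, rosenbrock, Matrix.fromBlocks_map, hA, hA, hA]
    congr 1
    · ext i j
      simp [Matrix.one_apply, apply_ite f]
    · ext; simp
  have h2 : Sum.elim (f ∘ v) (f ∘ w) = f ∘ Sum.elim v w := by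
    ext (i | i) <;> rfl
  rw [h1, h2]
  ext i
  exact (RingHom.map_mulVec (f : R →+* R') _ _ i).symm

end SwitchedSystem

namespace RowReduction

variable {n m p : ℕ} {S : SwitchedSystem n m p} {k : Fin (p + 1)} (D : RowReduction S k)

lemma rosenbrock_mulVec (q : Fin 2) (x : Fin (kerDim m k) → Rat2) :
    S.rosenbrock q k (ratVar q) *ᵥ Sum.elim (D.N q *ᵥ x) (D.M q *ᵥ x) = 0 := by
  have h : Matrix.fromRows (D.N q) (D.M q) *ᵥ x ∈
      LinearMap.ker (S.rosenbrock q k (ratVar q)).mulVecLin := by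
    rw [← D.range_eq_ker q]
    exact ⟨x, rfl⟩
  rw [Matrix.fromRows_mulVec] at h
  exact h

/-- `N_(k)` inherits full column rank from `[N_(k); M_(k)]`, because `N x = 0` forces `B M x = 0`,
and `B` has full column rank. -/
lemma injective_N (q : Fin 2) : Function.Injective (D.N q).mulVec := by
  have hinj := Matrix.mulVec_injective_iff.2 (D.linInd q)
  obtain ⟨Y, hY⟩ := exists_left_inverse_of_rank_eq (S.B q) (S.rank_B q)
  have key : ∀ x, D.N q *ᵥ x = 0 → x = 0 := by
    intro x hx
    have h := ((S.rosenbrock_mulVec_eq_zero_iff q k _ _ _).1 (D.rosenbrock_mulVec q x)).1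
    rw [hx] at h
    simp only [smul_zero, Matrix.mulVec_zero, sub_zero, zero_add] at h
    have hM : D.M q *ᵥ x = 0 := by
      have h' := congrArg (fun u => Y.map (algebraMap ℝ Rat2) *ᵥ u) h
      rwa [Matrix.mulVec_mulVec _ _ ((S.B q).map _), ← Matrix.map_mul, hY,
        Matrix.map_one _ (map_zero (algebraMap ℝ Rat2)) (map_one (algebraMap ℝ Rat2)),
        Matrix.one_mulVec, Matrix.mulVec_zero] at h'
    apply hinj
    rw [Matrix.fromRows_mulVec, hx, hM, Matrix.mulVec_zero]
    ext (i | i) <;> rfl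
  intro x y hxy
  have := key (x - y) (by rw [Matrix.mulVec_sub]; exact sub_eq_zero.2 hxy)
  exact sub_eq_zero.1 this

end RowReduction

namespace IntersectionRep

variable {n m p : ℕ} {S : SwitchedSystem n m p} {k : Fin (p + 1)} (D : IntersectionRep S k)

/-- The columns of `P_(k)` extend to polynomial kernel vectors of both Rosenbrock matrices: over the
rational functions they lie in the images of `N_{1,(k)}` and `N_{2,(k)}`, and the input part is
determined by a left inverse of `B_q`, hence polynomial. -/
lemma exists_polynomial_input (q : Fin 2) (j : Fin (kerDim m k)) :
    ∃ w : Fin m → Poly2,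
      S.rosenbrock q k (MvPolynomial.X q : Poly2) *ᵥ Sum.elim (D.P.col j) w = 0 := by
  let φ : Poly2 →ₐ[ℝ] Rat2 := IsScalarTower.toAlgHom ℝ Poly2 Rat2
  have hφ : Function.Injective φ := IsFractionRing.injective Poly2 Rat2
  obtain ⟨Y, hY⟩ := exists_left_inverse_of_rank_eq (S.B q) (S.rank_B q)
  obtain ⟨x, hx⟩ := rref_intersection D.N D.T D.T_unit D.rref (D.injective_N 0) j q
  have hcol : φ ∘ D.P.col j = D.N q *ᵥ (algebraMap Poly2 Rat2 (D.q j) • x) := by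
    rw [Matrix.mulVec_smul, hx]
    ext i
    have h := congrFun (congrFun D.P_eq i) j
    rw [Matrix.mul_diagonal, mul_comm] at h
    exact h
  have hker := D.rosenbrock_mulVec q (algebraMap Poly2 Rat2 (D.q j) • x)
  rw [← hcol] at hker
  set y := D.M q *ᵥ (algebraMap Poly2 Rat2 (D.q j) • x)
  set u := D.P.col j
  let w : Fin m → Poly2 := -(Y.map (algebraMap ℝ Poly2) *ᵥ
    ((MvPolynomial.X q : Poly2) • u - (S.A q).map (algebraMap ℝ Poly2) *ᵥ u))
  have hmap : ∀ {a b : ℕ} (Z : Matrix (Fin a) (Fin b) ℝ) (g : Fin b → Poly2),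
      φ ∘ (Z.map (algebraMap ℝ Poly2) *ᵥ g) = Z.map (algebraMap ℝ Rat2) *ᵥ (φ ∘ g) := by
    intro a b Z g
    ext i
    refine (RingHom.map_mulVec (φ : Poly2 →+* Rat2) _ _ i).trans ?_
    have hZ : (Z.map (algebraMap ℝ Poly2)).map φ = Z.map (algebraMap ℝ Rat2) := by
      ext i j
      exact φ.commutes _
    exact congrArg (fun Z' : Matrix (Fin a) (Fin b) Rat2 => (Z' *ᵥ (φ ∘ g)) i) hZ
  have hw : φ ∘ w = y := by
    have h := ((S.rosenbrock_mulVec_eq_zero_iff q k _ _ _).1 hker).1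
    have h' := congrArg (fun u => Y.map (algebraMap ℝ Rat2) *ᵥ u) h
    simp only [Matrix.mulVec_add, Matrix.mulVec_zero] at h'
    rw [Matrix.mulVec_mulVec _ _ ((S.B q).map _), ← Matrix.map_mul, hY,
      Matrix.map_one _ (map_zero (algebraMap ℝ Rat2)) (map_one (algebraMap ℝ Rat2)),
      Matrix.one_mulVec] at h'
    rw [← neg_eq_of_add_eq_zero_right h']
    have e1 : φ ∘ w = -(φ ∘ (Y.map (algebraMap ℝ Poly2) *ᵥ
        ((MvPolynomial.X q : Poly2) • u - (S.A q).map (algebraMap ℝ Poly2) *ᵥ u))) := by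
      ext i; simp [w]
    have e2 : φ ∘ ((MvPolynomial.X q : Poly2) • u - (S.A q).map (algebraMap ℝ Poly2) *ᵥ u) =
        ratVar q • (φ ∘ u) - φ ∘ ((S.A q).map (algebraMap ℝ Poly2) *ᵥ u) := by
      ext i
      simp only [Function.comp_apply, Pi.sub_apply, Pi.smul_apply, smul_eq_mul, map_sub, map_mul]
      rfl
    rw [e1, hmap, e2, hmap]
  refine ⟨w, ?_⟩
  have h := S.rosenbrock_map φ q k (MvPolynomial.X q) u w
  rw [hw] at h
  have hz : φ ∘ (S.rosenbrock q k (MvPolynomial.X q : Poly2) *ᵥ Sum.elim u w) = 0 :=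
    h.symm.trans hker
  ext i : 1
  exact hφ ((congrFun hz i).trans (map_zero φ).symm)

/-- Vectors of `im P_(k)(λ₁, λ₂)` are assignable as eigenvectors of both subsystems, at any point
`(λ₁, λ₂)`. -/
lemma exists_input {l : Fin 2 → ℝ} {v : Fin n → ℝ} (hv : v ∈ D.imP (l 0) (l 1)) (q : Fin 2) :
    ∃ w : Fin m → ℝ, S.rosenbrock q k (l q) *ᵥ Sum.elim v w = 0 := by
  obtain ⟨x, rfl⟩ := hv
  choose w hw using D.exists_polynomial_input q
  let ψ : Poly2 →ₐ[ℝ] ℝ := MvPolynomial.aeval ![l 0, l 1]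
  have hψ : ∀ f, ψ f = MvPolynomial.eval ![l 0, l 1] f := fun f => by
    simp [ψ, MvPolynomial.aeval_eq_eval]
  have hX : ψ (MvPolynomial.X q) = l q := by
    fin_cases q <;> simp [ψ]
  have hj : ∀ j, S.rosenbrock q k (l q) *ᵥ Sum.elim (ψ ∘ D.P.col j) (ψ ∘ w j) = 0 := by
    intro j
    rw [← hX, S.rosenbrock_map ψ, hw j]
    ext i
    simp
  refine ⟨∑ j, x j • (ψ ∘ w j), ?_⟩
  have hsum : Sum.elim ((D.P.map (MvPolynomial.eval ![l 0, l 1])).mulVecLin x)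
      (∑ j, x j • (ψ ∘ w j)) = ∑ j, x j • Sum.elim (ψ ∘ D.P.col j) (ψ ∘ w j) := by
    ext (i | i)
    · simp [Matrix.mulVec, dotProduct, hψ, mul_comm]
    · simp
  rw [hsum, Matrix.mulVec_sum]
  refine Finset.sum_eq_zero fun j _ => ?_
  rw [Matrix.mulVec_smul, hj, smul_zero]

end IntersectionRep
/-! ### Signs of combinations of two or three modes -/

lemma sign_eq_of_mul_pos {x y : ℝ} (h : 0 < x * y) : SignType.sign x = SignType.sign y := by
  rcases mul_pos_iff.1 h with ⟨hx, hy⟩ | ⟨hx, hy⟩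
  · rw [sign_pos hx, sign_pos hy]
  · rw [sign_neg hx, sign_neg hy]

/-- The sign of a combination of two modes is that of the coefficient of the slower one. -/
lemma sign_two_modes {a b A B : ℝ} (h : 0 < (a + b) * b) (hA : 0 < A) (hAB : A < B) :
    SignType.sign (a * A + b * B) = SignType.sign b := by
  apply sign_eq_of_mul_pos
  have hb : b ≠ 0 := fun hb => by simp [hb] at h
  nlinarith [mul_pos h hA, mul_pos (sub_pos.2 hAB) (mul_self_pos.2 hb)]

/-- The sign of a combination of three modes when the coefficient of the slowest is positive. -/
lemma three_modes_pos {a b c A B C : ℝ} (h1 : ¬ (0 ≤ a * b ∧ a * c < 0 ∧ |c| < |a + b|))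
    (h2 : ¬ (0 ≤ b * c ∧ a * b < 0 ∧ |b + c| < |a|)) (h3 : ¬ ((b + c) * c < 0)) (hc : 0 < c)
    (hA : 0 < A) (hAB : A < B) (hBC : B < C) : 0 < a * A + b * B + c * C := by
  have hbc : 0 ≤ b + c := by
    by_contra h
    exact h3 (mul_neg_of_neg_of_pos (not_le.1 h) hc)
  rcases le_or_gt 0 a with ha | ha
  · rcases le_or_gt 0 b with hb | hb
    · have := mul_nonneg ha hA.le
      have := mul_nonneg hb (hA.trans hAB).le
      have := mul_pos hc (hA.trans (hAB.trans hBC))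
      linarith
    · -- `b B + c C = (b + c) B + c (C - B)`
      have := mul_nonneg ha hA.le
      have := mul_nonneg hbc (hA.trans hAB).le
      have := mul_pos hc (sub_pos.2 hBC)
      nlinarith
  · rcases lt_or_ge 0 b with hb | hb
    · -- Condition II gives `0 ≤ a + b + c`.
      have h : |a| ≤ |b + c| := by
        by_contra h
        exact h2 ⟨(mul_pos hb hc).le, mul_neg_of_neg_of_pos ha hb, not_le.1 h⟩
      rw [abs_of_neg ha, abs_of_nonneg hbc] at h
      have := mul_nonneg (show 0 ≤ a + b + c by linarith) hA.le
      have := mul_pos hb (sub_pos.2 hAB)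
      have := mul_pos hc (sub_pos.2 (hAB.trans hBC))
      nlinarith
    · -- Condition I gives `0 ≤ a + b + c`.
      have h : |a + b| ≤ |c| := by
        by_contra h
        exact h1 ⟨mul_nonneg_of_nonpos_of_nonpos ha.le hb, mul_neg_of_neg_of_pos ha hc, not_le.1 h⟩
      rw [abs_of_neg (by linarith), abs_of_pos hc] at h
      have := mul_nonneg (show 0 ≤ a + b + c by linarith) (hA.trans (hAB.trans hBC)).le
      have := mul_pos (neg_pos.2 ha) (sub_pos.2 (hAB.trans hBC))
      have := mul_nonneg (neg_nonneg.2 hb) (sub_pos.2 hBC).le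
      nlinarith

/-- The sign of a combination of three modes satisfying the sign conditions does not depend on the
modes, only on their ordering. -/
lemma sign_three_modes {a b c A B C A' B' C' : ℝ}
    (h1 : ¬ (0 ≤ a * b ∧ a * c < 0 ∧ |c| < |a + b|))
    (h2 : ¬ (0 ≤ b * c ∧ a * b < 0 ∧ |b + c| < |a|)) (h3 : ¬ ((b + c) * c < 0))
    (hA : 0 < A) (hAB : A < B) (hBC : B < C) (hA' : 0 < A') (hAB' : A' < B') (hBC' : B' < C') :
    SignType.sign (a * A + b * B + c * C) = SignType.sign (a * A' + b * B' + c * C') := by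
  rcases lt_trichotomy c 0 with hc | rfl | hc
  · have h1' : ¬ (0 ≤ -a * -b ∧ -a * -c < 0 ∧ |-c| < |-a + -b|) := by
      rwa [neg_mul_neg, neg_mul_neg, ← neg_add, abs_neg, abs_neg]
    have h2' : ¬ (0 ≤ -b * -c ∧ -a * -b < 0 ∧ |-b + -c| < |-a|) := by
      rwa [neg_mul_neg, neg_mul_neg, ← neg_add, abs_neg, abs_neg]
    have h3' : ¬ ((-b + -c) * -c < 0) := by
      rwa [← neg_add, neg_mul_neg]
    have e := three_modes_pos h1' h2' h3' (neg_pos.2 hc) hA hAB hBC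
    have e' := three_modes_pos h1' h2' h3' (neg_pos.2 hc) hA' hAB' hBC'
    rw [sign_neg (by linarith), sign_neg (by linarith)]
  · -- Without the third mode, condition II leaves only the sign of `b`, or that of `a` if `b = 0`.
    simp only [zero_mul, add_zero]
    have key : ∀ {A B : ℝ}, 0 < A → A < B → b ≠ 0 →
        SignType.sign (a * A + b * B) = SignType.sign b := by
      intro A B hA hAB hb
      apply sign_eq_of_mul_pos
      have hab : 0 ≤ (a + b) * b := by
        rcases le_or_gt 0 (a * b) with h | h
        · nlinarith [mul_self_nonneg b]
        · have : |a| ≤ |b| := by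
            by_contra h'
            exact h2 ⟨by simp, h, by simpa using h'⟩
          nlinarith [abs_mul_abs_self b, neg_abs_le (a * b), abs_mul a b, abs_nonneg b]
      nlinarith [mul_nonneg hab hA.le, mul_pos (sub_pos.2 hAB) (mul_self_pos.2 hb)]
    by_cases hb : b = 0
    · simp [hb, sign_mul, sign_pos hA, sign_pos hA']
    · rw [key hA hAB hb, key hA' hAB' hb]
  · rw [sign_pos (three_modes_pos h1 h2 h3 hc hA hAB hBC),
      sign_pos (three_modes_pos h1 h2 h3 hc hA' hAB' hBC')]

/-- If the coefficients satisfy the sign conditions, the sign of a combination of at most three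
modes is determined by the ordering of the modes. -/
lemma sign_sum_modes {c : ℕ} (hc : c ≤ 3) {a : Fin c → ℝ} (ha : CoeffCondition c a)
    {E E' : Fin c → ℝ} (h0 : ∀ i, 0 < E i) (h0' : ∀ i, 0 < E' i) (hE : StrictMono E)
    (hE' : StrictMono E') :
    SignType.sign (∑ i, a i * E i) = SignType.sign (∑ i, a i * E' i) := by
  interval_cases c
  · simp
  · simp [sign_mul, sign_pos (h0 0), sign_pos (h0' 0)]
  · have h : 0 < (a 0 + a 1) * a 1 := ha
    have h01 : (0 : Fin 2) < 1 := by decide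
    simp only [Fin.sum_univ_two]
    rw [sign_two_modes h (h0 0) (hE h01), sign_two_modes h (h0' 0) (hE' h01)]
  · obtain ⟨h1, h2, h3⟩ := ha
    have h01 : (0 : Fin 3) < 1 := by decide
    have h12 : (1 : Fin 3) < 2 := by decide
    simp only [Fin.sum_univ_three]
    exact sign_three_modes h1 h2 h3 (h0 0) (hE h01) (hE h12) (h0' 0) (hE' h01) (hE' h12)

/-! ### Occupation times and scalar switched equations -/

/-- The time spent in mode `q` up to time `t`. -/
noncomputable def occupationTime (σ : ℝ → Fin 2) (q : Fin 2) (t : ℝ) : ℝ :=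
  ∫ s in (0 : ℝ)..t, if σ s = q then 1 else 0

lemma IsAdmissible.countable {σ : ℝ → Fin 2} (hσ : IsAdmissible σ) :
    {t : ℝ | 0 < t ∧ ¬ ContinuousAt σ t}.Countable := by
  refine Set.Countable.mono ?_ (Set.countable_iUnion fun N : ℕ => (hσ N).countable)
  rintro t ⟨ht, hc⟩
  obtain ⟨N, hN⟩ := exists_nat_ge t
  refine Set.mem_iUnion.2 ⟨N, ⟨ht.le, hN⟩, fun h => hc ?_⟩
  exact h.continuousAt (Ici_mem_nhds ht)

lemma IsAdmissible.aestronglyMeasurable {σ : ℝ → Fin 2} (hσ : IsAdmissible σ) (q : Fin 2) :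
    MeasureTheory.AEStronglyMeasurable (fun s => if σ s = q then (1 : ℝ) else 0)
      (MeasureTheory.volume.restrict (Set.Ioi 0)) := by
  have hcont : ContinuousOn (fun s => if σ s = q then (1 : ℝ) else 0)
      (Set.Ioi 0 \ {t : ℝ | 0 < t ∧ ¬ ContinuousAt σ t}) := by
    rintro t ⟨ht, hc⟩
    have : ContinuousAt σ t := by
      by_contra h
      exact hc ⟨ht, h⟩
    exact ((continuous_of_discreteTopology (f := fun r : Fin 2 => if r = q then (1 : ℝ) else 0)
      ).continuousAt.comp this).continuousWithinAt
  have hm := hcont.aestronglyMeasurable (μ := MeasureTheory.volume)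
    (measurableSet_Ioi.diff hσ.countable.measurableSet)
  rwa [MeasureTheory.Measure.restrict_congr_set] at hm
  exact MeasureTheory.sdiff_null_ae_eq_self (hσ.countable.measure_zero _)

lemma IsAdmissible.intervalIntegrable {σ : ℝ → Fin 2} (hσ : IsAdmissible σ) (q : Fin 2) {a b : ℝ}
    (ha : 0 ≤ a) (hb : 0 ≤ b) :
    IntervalIntegrable (fun s => if σ s = q then (1 : ℝ) else 0) MeasureTheory.volume a b := by
  rw [intervalIntegrable_iff]
  have hsub : Set.uIoc a b ⊆ Set.Ioi 0 := fun x hx => lt_of_le_of_lt (le_min ha hb) hx.1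
  have : MeasureTheory.IsFiniteMeasure (MeasureTheory.volume.restrict (Set.uIoc a b)) :=
    ⟨by simp [Set.uIoc]⟩
  refine MeasureTheory.Integrable.of_bound ((hσ.aestronglyMeasurable q).mono_set hsub) 1 ?_
  refine Filter.Eventually.of_forall fun s => ?_
  by_cases h : σ s = q <;> simp [h]

lemma occupationTime_nonneg (σ : ℝ → Fin 2) (q : Fin 2) {t : ℝ} (ht : 0 ≤ t) :
    0 ≤ occupationTime σ q t := by
  refine intervalIntegral.integral_nonneg ht fun s _ => ?_
  by_cases h : σ s = q <;> simp [h]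

lemma IsAdmissible.sum_occupationTime {σ : ℝ → Fin 2} (hσ : IsAdmissible σ) {t : ℝ} (ht : 0 ≤ t) :
    ∑ q, occupationTime σ q t = t := by
  unfold occupationTime
  rw [← intervalIntegral.integral_finsetSum fun q _ => hσ.intervalIntegrable q le_rfl ht]
  simp

lemma IsAdmissible.hasDerivAt_occupationTime {σ : ℝ → Fin 2} (hσ : IsAdmissible σ) (q : Fin 2)
    {t : ℝ} (ht : 0 < t) (hc : ContinuousAt σ t) :
    HasDerivAt (occupationTime σ q) (if σ t = q then 1 else 0) t := by
  refine intervalIntegral.integral_hasDerivAt_right (hσ.intervalIntegrable q le_rfl ht.le)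
    ⟨Set.Ioi 0, Ioi_mem_nhds ht, hσ.aestronglyMeasurable q⟩ ?_
  exact (continuous_of_discreteTopology (f := fun r : Fin 2 => if r = q then (1 : ℝ) else 0)
      ).continuousAt.comp hc

lemma IsAdmissible.continuousOn_occupationTime {σ : ℝ → Fin 2} (hσ : IsAdmissible σ) (q : Fin 2)
    (t : ℝ) (ht : 0 ≤ t) : ContinuousOn (occupationTime σ q) (Set.Icc 0 t) := by
  have h := intervalIntegral.continuousOn_primitive_interval'
    (hσ.intervalIntegrable q le_rfl ht) Set.left_mem_uIcc
  rwa [Set.uIcc_of_le ht] at h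

/-- The exponent at time `t` of the solutions of the scalar equation `y' = μ_σ y`. -/
noncomputable def modeExponent (μ : Fin 2 → ℝ) (σ : ℝ → Fin 2) (t : ℝ) : ℝ :=
  ∑ q, μ q * occupationTime σ q t

lemma IsAdmissible.eq_exp_modeExponent_mul {σ : ℝ → Fin 2} (hσ : IsAdmissible σ) (μ : Fin 2 → ℝ)
    {y : ℝ → ℝ} (hy : ContinuousOn y (Set.Ici 0))
    (hd : ∀ t, 0 < t → ContinuousAt σ t → HasDerivAt y (μ (σ t) * y t) t) {t : ℝ} (ht : 0 ≤ t) :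
    y t = Real.exp (modeExponent μ σ t) * y 0 := by
  -- `exp (-modeExponent) * y` has derivative zero off a countable set.
  have h := MeasureTheory.integral_eq_of_hasDerivAt_off_countable_of_le
    (fun t => Real.exp (-modeExponent μ σ t) * y t) (fun _ => (0 : ℝ)) ht hσ.countable
    (by
      refine ContinuousOn.mul (Real.continuous_exp.comp_continuousOn
        (ContinuousOn.neg ?_)) (hy.mono Set.Icc_subset_Ici_self)
      exact continuousOn_finsetSum _ fun q _ =>
        continuousOn_const.mul (hσ.continuousOn_occupationTime q t ht))
    (by
      rintro x ⟨hx, hxc⟩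
      have hc : ContinuousAt σ x := by
        by_contra h
        exact hxc ⟨hx.1, h⟩
      have h1 : HasDerivAt (modeExponent μ σ) (μ (σ x)) x := by
        have := HasDerivAt.fun_sum (u := Finset.univ) fun q _ =>
          (hσ.hasDerivAt_occupationTime q hx.1 hc).const_mul (μ q)
        have he : (fun y => ∑ q, μ q * occupationTime σ q y) = modeExponent μ σ := rfl
        rw [he] at this
        simpa using this
      exact (h1.fun_neg.exp.fun_mul (hd x hx.1 hc)).congr_deriv (by ring))
    (by simp)
  have h0 : modeExponent μ σ 0 = 0 := by simp [modeExponent, occupationTime]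
  simp only [intervalIntegral.integral_zero, h0, neg_zero, Real.exp_zero, one_mul] at h
  rw [← sub_eq_zero.1 h.symm, ← mul_assoc, ← Real.exp_add, add_neg_cancel, Real.exp_zero, one_mul]

lemma IsAdmissible.modeExponent_lt {σ : ℝ → Fin 2} (hσ : IsAdmissible σ) {μ ν : Fin 2 → ℝ}
    (h : ∀ q, μ q < ν q) {t : ℝ} (ht : 0 < t) : modeExponent μ σ t < modeExponent ν σ t := by
  have hs := hσ.sum_occupationTime ht.le
  have hpos : ∃ q, 0 < occupationTime σ q t := by
    by_contra! hcon
    exact absurd (Finset.sum_nonpos fun q _ => hcon q) (by rw [hs]; exact not_le.2 ht)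
  obtain ⟨q, hq⟩ := hpos
  exact Finset.sum_lt_sum
    (fun q _ => mul_le_mul_of_nonneg_right (h q).le (occupationTime_nonneg σ q ht.le))
    ⟨q, Finset.mem_univ q, mul_lt_mul_of_pos_right (h q) hq⟩

lemma IsAdmissible.modeExponent_le {σ : ℝ → Fin 2} (hσ : IsAdmissible σ) {μ : Fin 2 → ℝ} {c : ℝ}
    (h : ∀ q, μ q ≤ c) {t : ℝ} (ht : 0 ≤ t) : modeExponent μ σ t ≤ c * t := by
  refine le_of_le_of_eq ?_ (congrArg (c * ·) (hσ.sum_occupationTime ht))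
  rw [Finset.mul_sum]
  exact Finset.sum_le_sum fun q _ =>
    mul_le_mul_of_nonneg_right (h q) (occupationTime_nonneg σ q ht)

/-! ### Simultaneously diagonalisable closed loops -/

section Diagonal

variable {n : ℕ} {M : Fin 2 → Matrix (Fin n) (Fin n) ℝ} {b : Fin 2 → Fin n → ℝ} {xe : Fin n → ℝ}
  {V : Matrix (Fin n) (Fin n) ℝ} {μ : Fin 2 → Fin n → ℝ}

/-- In coordinates with respect to common eigenvectors, the trajectories decouple. -/
lemma IsTrajectory.modes_eq (hV : IsUnit V.det) (hM : ∀ q, M q * V = V * Matrix.diagonal (μ q))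
    (he : ∀ q, M q *ᵥ xe + b q = 0) {σ : ℝ → Fin 2} (hσ : IsAdmissible σ) {x₀ : Fin n → ℝ}
    {x : ℝ → Fin n → ℝ} (hx : IsTrajectory M b σ x₀ x) {t : ℝ} (ht : 0 ≤ t) (j : Fin n) :
    (V⁻¹ *ᵥ (x t - xe)) j =
      Real.exp (modeExponent (fun q => μ q j) σ t) * (V⁻¹ *ᵥ (x₀ - xe)) j := by
  obtain ⟨hcont, rfl, hderiv⟩ := hx
  have hUM : ∀ q, V⁻¹ * M q = Matrix.diagonal (μ q) * V⁻¹ := by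
    intro q
    calc V⁻¹ * M q = V⁻¹ * (M q * V) * V⁻¹ := by
          rw [Matrix.mul_assoc, Matrix.mul_assoc, Matrix.mul_nonsing_inv _ hV, Matrix.mul_one]
      _ = Matrix.diagonal (μ q) * V⁻¹ := by
          rw [hM, ← Matrix.mul_assoc, Matrix.nonsing_inv_mul _ hV, Matrix.one_mul]
  refine hσ.eq_exp_modeExponent_mul (fun q => μ q j) (y := fun t => (V⁻¹ *ᵥ (x t - xe)) j) ?_ ?_ ht
  · exact (by fun_prop : Continuous fun u : Fin n → ℝ => (V⁻¹ *ᵥ (u - xe)) j).comp_continuousOn hcont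
  · intro t ht hc
    have h := hderiv t ht hc
    have hrhs : M (σ t) *ᵥ x t + b (σ t) = M (σ t) *ᵥ (x t - xe) := by
      rw [Matrix.mulVec_sub, eq_neg_of_add_eq_zero_right (he (σ t)), sub_eq_add_neg]
    rw [hrhs] at h
    have h' := ((Matrix.mulVecLin V⁻¹).toContinuousLinearMap.hasFDerivAt.comp_hasDerivAt t
      (h.sub_const xe))
    have h'' := hasDerivAt_pi.1 h' j
    have hval : (V⁻¹ *ᵥ (M (σ t) *ᵥ (x t - xe))) j = μ (σ t) j * (V⁻¹ *ᵥ (x t - xe)) j := by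
      rw [Matrix.mulVec_mulVec, hUM, ← Matrix.mulVec_mulVec, Matrix.mulVec_diagonal]
    rw [← hval]
    exact h''

/-- With common eigenvectors and negative eigenvalues, trajectories converge exponentially to the
equilibrium, at a rate which does not depend on the switching signal. -/
lemma exists_exponential_bound (hV : IsUnit V.det)
    (hM : ∀ q, M q * V = V * Matrix.diagonal (μ q)) (hμ : ∀ q j, μ q j < 0)
    (he : ∀ q, M q *ᵥ xe + b q = 0) :
    ∃ K c : ℝ, 0 < K ∧ 0 < c ∧ ∀ (σ : ℝ → Fin 2) (x₀ : Fin n → ℝ) (x : ℝ → Fin n → ℝ),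
      IsAdmissible σ → IsTrajectory M b σ x₀ x → ∀ t : ℝ, 0 ≤ t →
        ‖x t - xe‖ ≤ K * Real.exp (-c * t) * ‖x₀ - xe‖ := by
  obtain ⟨c, hc, hcμ⟩ : ∃ c : ℝ, 0 < c ∧ ∀ q j, μ q j ≤ -c := by
    have hfin : ∀ a : Fin 2 × Fin n, ∀ᶠ c : ℝ in 𝓝[>] 0, μ a.1 a.2 < -c := by
      intro a
      have h : Tendsto (fun c : ℝ => -c) (𝓝[>] 0) (𝓝 0) := by
        have : Tendsto (fun c : ℝ => -c) (𝓝 0) (𝓝 (-0)) := tendsto_id.neg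
        rw [neg_zero] at this
        exact this.mono_left nhdsWithin_le_nhds
      exact h.eventually (lt_mem_nhds (hμ a.1 a.2))
    obtain ⟨c, h1, h2⟩ := ((eventually_all.2 hfin).and self_mem_nhdsWithin).exists
    exact ⟨c, h2, fun q j => (h1 (q, j)).le⟩
  let f := V.mulVecLin.toContinuousLinearMap
  let g := V⁻¹.mulVecLin.toContinuousLinearMap
  refine ⟨(‖f‖ + 1) * (‖g‖ + 1), c, by positivity, hc, ?_⟩
  intro σ x₀ x hσ hx t ht
  have hz : ‖V⁻¹ *ᵥ (x t - xe)‖ ≤ Real.exp (-c * t) * ‖V⁻¹ *ᵥ (x₀ - xe)‖ := by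
    rw [pi_norm_le_iff_of_nonneg (by positivity)]
    intro j
    rw [hx.modes_eq hV hM he hσ ht j, norm_mul, Real.norm_eq_abs, Real.abs_exp]
    exact mul_le_mul (Real.exp_le_exp.2 (hσ.modeExponent_le (fun q => hcμ q j) ht))
      (norm_le_pi_norm _ j) (norm_nonneg _) (Real.exp_pos _).le
  have hback : x t - xe = f (V⁻¹ *ᵥ (x t - xe)) := by
    change _ = V *ᵥ (V⁻¹ *ᵥ (x t - xe))
    rw [Matrix.mulVec_mulVec, Matrix.mul_nonsing_inv _ hV, Matrix.one_mulVec]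
  have hg : ‖V⁻¹ *ᵥ (x₀ - xe)‖ ≤ ‖g‖ * ‖x₀ - xe‖ := g.le_opNorm (x₀ - xe)
  calc ‖x t - xe‖ ≤ ‖f‖ * ‖V⁻¹ *ᵥ (x t - xe)‖ := by
        conv_lhs => rw [hback]
        exact f.le_opNorm _
    _ ≤ (‖f‖ + 1) * (Real.exp (-c * t) * ((‖g‖ + 1) * ‖x₀ - xe‖)) := by
        refine mul_le_mul (by linarith) (hz.trans ?_) (norm_nonneg _) (by positivity)
        refine mul_le_mul_of_nonneg_left (hg.trans ?_) (Real.exp_pos _).le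
        exact mul_le_mul_of_nonneg_right (by linarith) (norm_nonneg _)
    _ = _ := by ring

lemma tendsto_mul_exp_neg_mul (K : ℝ) {c : ℝ} (hc : 0 < c) :
    Tendsto (fun t => K * Real.exp (-c * t)) atTop (𝓝 0) := by
  have h : Tendsto (fun t : ℝ => -c * t) atTop atBot :=
    tendsto_id.const_mul_atTop_of_neg (neg_lt_zero.2 hc)
  simpa using (Real.tendsto_exp_atBot.comp h).const_mul K

lemma isGUAS_of_exponential_bound (he : ∀ q, M q *ᵥ xe + b q = 0) {K c : ℝ} (hK : 0 < K)
    (hc : 0 < c) (h : ∀ (σ : ℝ → Fin 2) (x₀ : Fin n → ℝ) (x : ℝ → Fin n → ℝ),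
      IsAdmissible σ → IsTrajectory M b σ x₀ x → ∀ t : ℝ, 0 ≤ t →
        ‖x t - xe‖ ≤ K * Real.exp (-c * t) * ‖x₀ - xe‖) : IsGUAS M b xe := by
  refine ⟨he, ?_, ?_⟩
  · intro ε hε
    refine ⟨ε / K, by positivity, fun σ x₀ x hσ hx h0 t ht => ?_⟩
    have h1 : Real.exp (-c * t) ≤ 1 := Real.exp_le_one_iff.2 (by nlinarith)
    calc ‖x t - xe‖ ≤ K * Real.exp (-c * t) * ‖x₀ - xe‖ := h σ x₀ x hσ hx t ht
      _ ≤ K * 1 * ‖x₀ - xe‖ := by gcongr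
      _ < K * 1 * (ε / K) := by gcongr
      _ = ε := by field_simp
  · intro ρ ε hρ hε
    have hlim := tendsto_mul_exp_neg_mul (K * ρ) hc
    obtain ⟨T, hT⟩ := eventually_atTop.1 (hlim.eventually (gt_mem_nhds hε))
    refine ⟨max T 0, le_max_right _ _, fun σ x₀ x hσ hx h0 t ht => ?_⟩
    calc ‖x t - xe‖ ≤ K * Real.exp (-c * t) * ‖x₀ - xe‖ :=
          h σ x₀ x hσ hx t ((le_max_right _ _).trans ht)
      _ ≤ K * Real.exp (-c * t) * ρ := by gcongr
      _ = K * ρ * Real.exp (-c * t) := by ring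
      _ < ε := hT t ((le_max_left _ _).trans ht)

end Diagonal

/-! ### Modal coordinates -/

section Modal

variable {n p : ℕ} {d : Fin (p + 1) → ℕ} (hd : IsPartitioning n d)

lemma colMatrix_col {a : ℕ} (v : ∀ k, Fin (d k) → Fin a → ℝ) (j : Fin n) :
    (colMatrix hd v).col j = v ((colIndex hd).symm j).1 ((colIndex hd).symm j).2 := rfl

lemma isUnit_det_colMatrix {v : ∀ k, Fin (d k) → Fin n → ℝ}
    (hli : LinearIndependent ℝ (fun a : Σ k, Fin (d k) => v a.1 a.2)) :
    IsUnit (colMatrix hd v).det := by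
  rw [← Matrix.isUnit_iff_isUnit_det, ← Matrix.linearIndependent_cols_iff_isUnit]
  exact hli.comp _ (colIndex hd).symm.injective

lemma sum_modalCoeff_smul {v : ∀ k, Fin (d k) → Fin n → ℝ}
    (hV : IsUnit (colMatrix hd v).det) (ξ : Fin n → ℝ) :
    ∑ k, ∑ i, modalCoeff hd v ξ k i • v k i = ξ := by
  have h : colMatrix hd v *ᵥ ((colMatrix hd v)⁻¹ *ᵥ ξ) = ξ := by
    rw [Matrix.mulVec_mulVec, Matrix.mul_nonsing_inv _ hV, Matrix.one_mulVec]
  conv_rhs => rw [← h]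
  rw [Matrix.mulVec_eq_sum, ← Equiv.sum_comp (colIndex hd), Fintype.sum_sigma]
  refine Finset.sum_congr rfl fun k _ => Finset.sum_congr rfl fun i _ => ?_
  rw [op_smul_eq_smul]
  refine congrArg _ ?_
  have := colMatrix_col hd v (colIndex hd ⟨k, i⟩)
  rw [Equiv.symm_apply_apply] at this
  exact this.symm

/-- Membership in the set of initial states is a condition on the modal coefficients, as the
coefficients in `setH` are unique. -/
lemma coeffCondition_of_mem_setX {v : ∀ k, Fin (d k) → Fin n → ℝ}
    (hli : LinearIndependent ℝ (fun a : Σ k, Fin (d k) => v a.1 a.2)) {xss x₀ : Fin n → ℝ}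
    (hx : x₀ ∈ setX hd v xss) (k : Fin p) :
    CoeffCondition (d k.succ) (modalCoeff hd v (x₀ - xss) k.succ) := by
  obtain ⟨a, ha, hcond⟩ := hx k.succ
  have hlik : LinearIndependent ℝ (v k.succ) :=
    hli.comp (fun i => (⟨k.succ, i⟩ : Σ k, Fin (d k))) fun i j h => by simpa using h
  have h := Fintype.linearIndependent_iff.1 hlik
    (fun i => modalCoeff hd v (x₀ - xss) k.succ i - a i) (by
      simp only [sub_smul, Finset.sum_sub_distrib]
      exact sub_eq_zero.2 ha)
  have : modalCoeff hd v (x₀ - xss) k.succ = a := funext fun i => sub_eq_zero.1 (h i)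
  rw [this]
  exact hcond (Fin.succ_ne_zero k)

end Modal

/-- The feedback built from kernel vectors of the Rosenbrock matrices makes the `v_{k,i}`
eigenvectors of both closed-loop matrices. -/
lemma SwitchedSystem.closedLoop_mul_colMatrix {n m p : ℕ} (S : SwitchedSystem n m p)
    {d : Fin (p + 1) → ℕ} (hd : IsPartitioning n d) {L : Fin 2 → ∀ k, Fin (d k) → ℝ}
    {v : ∀ k, Fin (d k) → Fin n → ℝ} {w : Fin 2 → ∀ k, Fin (d k) → Fin m → ℝ}
    (hV : IsUnit (colMatrix hd v).det)
    (hw : ∀ q k i, S.rosenbrock q k (L q k i) *ᵥ Sum.elim (v k i) (w q k i) = 0)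
    {F : Fin 2 → Matrix (Fin m) (Fin n) ℝ}
    (hF : ∀ q, F q = -(colMatrix hd (w q) * (colMatrix hd v)⁻¹)) (q : Fin 2) :
    S.closedLoop F q * colMatrix hd v = colMatrix hd v *
      Matrix.diagonal (fun j => L q ((colIndex hd).symm j).1 ((colIndex hd).symm j).2) := by
  have hFV : F q * colMatrix hd v = -colMatrix hd (w q) := by
    rw [hF, Matrix.neg_mul, Matrix.mul_assoc, Matrix.nonsing_inv_mul _ hV, Matrix.mul_one]
  rw [closedLoop, Matrix.add_mul, Matrix.mul_assoc, hFV]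
  ext i j
  have h := congrFun ((S.rosenbrock_mulVec_eq_zero_iff q _ _ _ _).1
    (hw q ((colIndex hd).symm j).1 ((colIndex hd).symm j).2)).1 i
  rw [← colMatrix_col hd v, ← colMatrix_col hd (w q)] at h
  have hA : (S.A q).map (algebraMap ℝ ℝ) = S.A q := rfl
  have hB : (S.B q).map (algebraMap ℝ ℝ) = S.B q := rfl
  rw [hA, hB] at h
  have h1 : (S.A q *ᵥ (colMatrix hd v).col j) i = (S.A q * colMatrix hd v) i j := rfl
  have h2 : (S.B q *ᵥ (colMatrix hd (w q)).col j) i = (S.B q * colMatrix hd (w q)) i j := rfl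
  simp only [Pi.add_apply, Pi.sub_apply, Pi.smul_apply, smul_eq_mul, Pi.zero_apply, h1, h2,
    Matrix.col_apply] at h
  rw [Matrix.mul_neg, Matrix.add_apply, Matrix.neg_apply, Matrix.mul_diagonal]
  linarith

end SwitchedTracking

open SwitchedTracking in
theorem mainTheorem1 {n m p : ℕ} (S : SwitchedTracking.SwitchedSystem n m p)
    (hS : S.StandingAssumption)
    (r : Fin p → ℝ) (xss : Fin n → ℝ) (uss : Fin 2 → Fin m → ℝ)
    (hss : S.IsSteadyState r xss uss)
    (D : ∀ k : Fin (p + 1), SwitchedTracking.IntersectionRep S k)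
    (d : Fin (p + 1) → ℕ) (hd : SwitchedTracking.IsPartitioning n d)
    (hfeas : SwitchedTracking.IsFeasible D d)
    (L : Fin 2 → ∀ k : Fin (p + 1), Fin (d k) → ℝ)
    (hL : ∀ q, SwitchedTracking.IsCompatible (L q))
    (hneg : ∀ q k i, L q k i < 0)
    (hG : ∀ k i j, ![L 0 k i, L 1 k j] ∈ (D k).G)
    (hdim : ∀ I : Finset (Fin p), d 0 + ∑ k ∈ I, d k.succ ≤
      Module.finrank ℝ ↥(SwitchedTracking.sumP D L 0 ⊔ ⨆ k ∈ I, SwitchedTracking.sumP D L k.succ))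
    (v : ∀ k : Fin (p + 1), Fin (d k) → Fin n → ℝ)
    (hv : ∀ k i, v k i ∈ (D k).imP (L 0 k i) (L 1 k i))
    (hli : LinearIndependent ℝ (fun a : Σ k, Fin (d k) => v a.1 a.2))
    (s : Fin p → ℝ)
    (hs : ∀ (k : Fin p) (i : Fin (d k.succ)), S.C *ᵥ v k.succ i = Pi.single k (s k)) :
    ∃ (w : Fin 2 → ∀ k : Fin (p + 1), Fin (d k) → Fin m → ℝ)
      (F : Fin 2 → Matrix (Fin m) (Fin n) ℝ) (g : Fin 2 → Fin m → ℝ),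
      (∀ q k i, S.rosenbrock q k (L q k i) *ᵥ Sum.elim (v k i) (w q k i) = 0) ∧
      (∀ q, F q = -(SwitchedTracking.colMatrix hd (w q) * (SwitchedTracking.colMatrix hd v)⁻¹)) ∧
      (∀ q, g q = -(F q *ᵥ xss) + uss q) ∧
      SwitchedTracking.IsGUAS (S.closedLoop F) (fun q => S.B q *ᵥ g q) xss ∧
      ∀ x₀ ∈ SwitchedTracking.setX hd v xss, ∀ σ : ℝ → Fin 2, SwitchedTracking.IsAdmissible σ →
        ∀ x : ℝ → Fin n → ℝ,
          SwitchedTracking.IsTrajectory (S.closedLoop F) (fun q => S.B q *ᵥ g q) σ x₀ x →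
            SwitchedTracking.IsNonOvershooting (fun t => r - S.C *ᵥ x t) := by
  choose w hw using fun q k i =>
    (D k).exists_input (l := fun q => L q k i) (hv k i) q
  have hV := isUnit_det_colMatrix hd hli
  let F : Fin 2 → Matrix (Fin m) (Fin n) ℝ := fun q => -(colMatrix hd (w q) * (colMatrix hd v)⁻¹)
  let g : Fin 2 → Fin m → ℝ := fun q => -(F q *ᵥ xss) + uss q
  have hM := S.closedLoop_mul_colMatrix hd hV hw (F := F) fun q => rfl
  have he : ∀ q, S.closedLoop F q *ᵥ xss + S.B q *ᵥ g q = 0 := by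
    intro q
    rw [← hss.1 q]
    simp only [SwitchedSystem.closedLoop, g, Matrix.add_mulVec, Matrix.mulVec_add,
      Matrix.mulVec_neg, Matrix.mulVec_mulVec]
    abel
  obtain ⟨K, c, hK, hc, hbound⟩ := exists_exponential_bound hV hM (fun q j => hneg q _ _) he
  refine ⟨w, F, g, hw, fun q => rfl, fun q => rfl,
    isGUAS_of_exponential_bound he hK hc hbound, ?_⟩
  intro x₀ hx₀ σ hσ x hx
  have herr : ∀ t, r - S.C *ᵥ x t = -(S.C *ᵥ (x t - xss)) := by
    intro t
    rw [Matrix.mulVec_sub, hss.2, neg_sub]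
  simp only [herr]
  have hmodes : ∀ t, 0 ≤ t → ∀ a : Σ k, Fin (d k), modalCoeff hd v (x t - xss) a.1 a.2 =
      Real.exp (modeExponent (fun q => L q a.1 a.2) σ t) *
        modalCoeff hd v (x₀ - xss) a.1 a.2 := by
    intro t ht a
    obtain ⟨j, rfl⟩ := (colIndex hd).symm.surjective a
    simp only [modalCoeff, Sigma.eta, Equiv.apply_symm_apply]
    exact hx.modes_eq hV hM he hσ ht j
  constructor
  · have h0 : Tendsto (fun t => x t - xss) atTop (𝓝 0) := by
      refine squeeze_zero_norm' ?_ (tendsto_mul_exp_neg_mul (K * ‖x₀ - xss‖) hc)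
      filter_upwards [eventually_ge_atTop 0] with t ht
      exact (hbound σ x₀ x hσ hx t ht).trans_eq (by ring)
    have hcont : Continuous fun u : Fin n → ℝ => -(S.C *ᵥ u) := by fun_prop
    simpa [Function.comp_def] using (hcont.tendsto 0).comp h0
  · intro k
    -- Only the modes assigned to the `k`-th component are visible in it.
    have hrow : ∀ t, 0 < t → (S.C *ᵥ (x t - xss)) k =
        (∑ i, modalCoeff hd v (x₀ - xss) k.succ i *
          Real.exp (modeExponent (fun q => L q k.succ i) σ t)) * s k := by
      intro t ht
      conv_lhs => rw [← sum_modalCoeff_smul hd hV (x t - xss)]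
      have hv0 : ∀ i, (S.C *ᵥ v 0 i) k = 0 := fun i =>
        congrFun ((S.rosenbrock_mulVec_eq_zero_iff 0 0 _ _ _).1 (hw 0 0 i)).2
          ⟨k, Fin.succ_ne_zero k⟩
      rw [Fin.sum_univ_succ]
      simp only [Matrix.mulVec_add, Matrix.mulVec_sum, Matrix.mulVec_smul, hs, Pi.add_apply,
        Finset.sum_apply, Pi.smul_apply, hv0, smul_eq_mul, mul_zero, Finset.sum_const_zero,
        zero_add]
      rw [Finset.sum_eq_single k]
      · rw [Finset.sum_mul]
        refine Finset.sum_congr rfl fun i _ => ?_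
        rw [Pi.single_eq_same, hmodes t ht.le ⟨k.succ, i⟩, mul_comm (Real.exp _)]
      · intro k' _ hk'
        simp [Pi.single_eq_of_ne hk'.symm]
      · simp
    have hmono : ∀ t, 0 < t →
        StrictMono fun i => Real.exp (modeExponent (fun q => L q k.succ i) σ t) :=
      fun t ht i j hij => Real.exp_lt_exp.2
        (hσ.modeExponent_lt (fun q => (hL q).strictMono k hij) ht)
    intro t₁ t₂ h₁ h₂
    simp only [Pi.neg_apply, Left.sign_neg, hrow _ h₁, hrow _ h₂, sign_mul]
    rw [sign_sum_modes (hd.le_three k) (coeffCondition_of_mem_setX hd hli hx₀ k)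
      (fun i => Real.exp_pos _) (fun i => Real.exp_pos _) (hmono t₁ h₁) (hmono t₂ h₂)]
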